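/- Let $D$ be an integral domain with quotient field $K$. Let $\mathrm{Zar}(D)$ be the set of valuation overrings of $D$, that is, of all valuation rings $V$ with $D\subseteq V\subseteq K$ and quotient field $K$ (including $K$ itself), endowed with the Zariski topology, which is generated by the sets $B(x_1,\ldots,x_n)=\{V\in\mathrm{Zar}(D)\mid x_1,\ldots,x_n\in V\}$ for finite subsets $\{x_1,\ldots,x_n\}$ of $K$. Let $\dim$ denote Krull dimension, with values in $\{0,1,2,\ldots,\infty\}$, and let $\dim_v(D)=\sup\{\dim V\mid V\in\mathrm{Zar}(D)\}$ be the valuative dimension of $D$. Here "compact" does not include the Hausdorff condition, and a space is Noetherian if its open subsets satisfy the ascending chain condition. (1) Let $V$ be a minimal element, with respect to inclusion, of $\mathrm{Zar}(D)$ such that $\mathrm{Zar}(D)\setminus\{V\}$ is compact, and let $\iota_V:\mathrm{Spec}(V)\to\mathrm{Spec}(D)$, $Q\mapsto Q\cap D$, be the map induced by the inclusion $D\subseteq V$. Then $|\iota_V^{-1}(P)|\leq 2$ for every $P\in\mathrm{Spec}(D)$, and $\dim(V)\leq 2\dim(D)$. (2) If $\mathrm{Zar}(D)$ is a Noetherian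 space, then $\dim_v(D)\leq 2\dim(D)$. -/

import Mathlib

/-- The Zariski space `Zar(D)` of an integral domain `D` with quotient field `K`: the set of all
valuation overrings of `D`, i.e. of all valuation rings of `K` containing (the image of) `D`. -/
def Zar (D K : Type*) [CommRing D] [Field K] [Algebra D K] : Type _ :=
  {V : ValuationSubring K // ∀ d : D, algebraMap D K d ∈ V}

namespace Zar

variable {D K : Type*} [CommRing D] [Field K] [Algebra D K]

/-- The valuation ring underlying a point of the Zariski space, as a subring of `K`. -/
def ring (V : Zar D K) : ValuationSubring K := V.1

/-- Valuation overrings are ordered by inclusion. -/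
instance : PartialOrder (Zar D K) :=
  PartialOrder.lift Zar.ring Subtype.val_injective

/-- The set `B(x₁, …, xₙ)` of the valuation overrings of `D` containing `x₁, …, xₙ ∈ K`. -/
def basicOpen (D : Type*) {K : Type*} [CommRing D] [Field K] [Algebra D K] (F : Finset K) :
    Set (Zar D K) :=
  {V | ∀ x ∈ F, x ∈ V.ring}

/-- The Zariski topology on `Zar(D)`, generated by the sets `B(x₁, …, xₙ)`. -/
instance : TopologicalSpace (Zar D K) :=
  TopologicalSpace.generateFrom (Set.range (basicOpen D (K := K)))

/-- The inclusion `D ↪ V` of `D` in a valuation overring `V`. -/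
def incl (V : Zar D K) : D →+* V.ring :=
  (algebraMap D K).codRestrict V.ring.toSubring V.2

/-- The spectral map `ι_V : Spec(V) → Spec(D)`, `Q ↦ Q ∩ D`, associated to `D ↪ V`. -/
def specMap (V : Zar D K) : PrimeSpectrum V.ring → PrimeSpectrum D :=
  PrimeSpectrum.comap V.incl

end Zar

/-- The valuative dimension `dim_v(D)` of a domain `D` with quotient field `K`: the supremum of the
Krull dimensions of the valuation overrings of `D`. -/
noncomputable def valuativeDim (D K : Type*) [CommRing D] [Field K] [Algebra D K] :
    WithBot ℕ∞ :=
  ⨆ V : Zar D K, ringKrullDim V.ring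

/-! Compactness yields a finite set `S` in the maximal ideal of `V` such that `V` is the only
valuation overring whose maximal ideal contains `S`. Localize `D[S]` at the centre of `V` to get
`R`. Valuation rings of `K` dominating `R` equal `V`, so `V` is integral over `R`, and Spec `R` is a
chain because Spec `V` is. The fibres of Spec `R` over Spec `D` are spectra of Noetherian rings, and
Krull's principal ideal theorem allows at most two primes in a Noetherian chain. By incomparability
the same holds for `V`. The fibre over zero is a single point, whence the bound `2 * dim D` without
an additive term. In the Noetherian case every valuation overring contains a minimal one, of at
least the same dimension. -/

open IsLocalRing Algebra

section NoetherianSpectra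

/-- A Noetherian ring whose spectrum is totally ordered has no strict chain of three primes. -/
theorem PrimeSpectrum.not_lt_of_lt_of_total {R : Type*} [CommRing R] [IsNoetherianRing R]
    (htot : ∀ p q : PrimeSpectrum R, p ≤ q ∨ q ≤ p) {p₁ p₂ p₃ : PrimeSpectrum R}
    (h₁₂ : p₁ < p₂) : ¬ p₂ < p₃ := by
  intro h₂₃
  obtain ⟨x, hx₃, hx₂⟩ := SetLike.exists_of_lt (show p₂.asIdeal < p₃.asIdeal from h₂₃)
  have hp₃ := p₃.isPrime
  -- The prime `p₃` only ensures that `x` is a nonunit. By totality `q` lies strictly above `p₂`, so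
  -- its height is at least 2, against Krull's bound.
  obtain ⟨q, hq, -⟩ := Ideal.exists_minimalPrimes_le
    ((Ideal.span_singleton_le_iff_mem p₃.asIdeal).2 hx₃)
  have hq_prime : q.IsPrime := hq.1.1
  have hxq : x ∈ q := hq.1.2 (Ideal.mem_span_singleton_self x)
  have h₂q : p₂ < ⟨q, hq_prime⟩ := by
    refine lt_of_le_not_ge ((htot p₂ ⟨q, hq_prime⟩).resolve_right fun h => hx₂ (h hxq)) ?_
    exact fun h => hx₂ (h hxq)
  have hle := Ideal.height_le_one_of_isPrincipal_of_mem_minimalPrimes _ q hq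
  have hp₁ := p₁.isPrime
  have hp₂ := p₂.isPrime
  have h1 : p₁.asIdeal.height + 1 ≤ p₂.asIdeal.height :=
    Ideal.height_add_one_le_of_lt_of_isPrime h₁₂
  have h2 : p₂.asIdeal.height + 1 ≤ q.height :=
    Ideal.height_add_one_le_of_lt_of_isPrime h₂q
  have h3 : (0 : ℕ∞) + 1 + 1 ≤ 1 :=
    calc (0 : ℕ∞) + 1 + 1 ≤ p₁.asIdeal.height + 1 + 1 := by gcongr; exact zero_le
      _ ≤ p₂.asIdeal.height + 1 := by gcongr
      _ ≤ q.height := h2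
      _ ≤ 1 := hle
  norm_num at h3

/-- Let `S` be integral over a subring `R` which is essentially of finite type over `D`. If the
spectrum of `S` is totally ordered, then there is no strict chain of three primes of `S` with the
same contraction to `D`. -/
theorem PrimeSpectrum.not_lt_of_lt_of_comap_eq {D R S : Type*} [CommRing D] [CommRing R]
    [CommRing S] [Algebra D R] [Algebra R S] [Algebra D S] [IsScalarTower D R S]
    [EssFiniteType D R] [Algebra.IsIntegral R S] [FaithfulSMul R S]
    (htot : ∀ p q : PrimeSpectrum S, p ≤ q ∨ q ≤ p) {P : PrimeSpectrum D}
    {q₁ q₂ q₃ : PrimeSpectrum S} (h₁ : comap (algebraMap D S) q₁ = P)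
    (h₂ : comap (algebraMap D S) q₂ = P) (h₃ : comap (algebraMap D S) q₃ = P)
    (h₁₂ : q₁ < q₂) : ¬ q₂ < q₃ := by
  intro h₂₃
  have hstrict {a b : PrimeSpectrum S} (hab : a < b) :
      comap (algebraMap R S) a < comap (algebraMap R S) b := by
    obtain ⟨x, hxb, hxa⟩ := SetLike.exists_of_lt (show a.asIdeal < b.asIdeal from hab)
    have := a.isPrime
    exact Ideal.comap_lt_comap_of_integral_mem_sdiff (R := R) (I := a.asIdeal) (J := b.asIdeal)
      hab.le ⟨hxb, hxa⟩ (Algebra.IsIntegral.isIntegral x)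
  have htotR (p q : PrimeSpectrum R) : p ≤ q ∨ q ≤ p := by
    obtain ⟨p, rfl⟩ := Algebra.IsIntegral.comap_surjective R S p
    obtain ⟨q, rfl⟩ := Algebra.IsIntegral.comap_surjective R S q
    exact (htot p q).imp (fun h => Ideal.comap_mono h) (fun h => Ideal.comap_mono h)
  have hfib {q : PrimeSpectrum S} (h : comap (algebraMap D S) q = P) :
      comap (algebraMap R S) q ∈ comap (algebraMap D R) ⁻¹' {P} := by
    rw [Set.mem_preimage, Set.mem_singleton_iff, ← h, IsScalarTower.algebraMap_eq D R S]
    rfl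
  let e := PrimeSpectrum.preimageOrderIsoFiber D R P
  have : IsNoetherianRing (P.asIdeal.Fiber R) :=
    Algebra.EssFiniteType.isNoetherianRing P.asIdeal.ResidueField _
  refine PrimeSpectrum.not_lt_of_lt_of_total (R := P.asIdeal.Fiber R) (fun p q => ?_)
    (p₁ := e ⟨_, hfib h₁⟩) (p₂ := e ⟨_, hfib h₂⟩) (p₃ := e ⟨_, hfib h₃⟩)
    (e.lt_iff_lt.2 (hstrict h₁₂)) (e.lt_iff_lt.2 (hstrict h₂₃))
  rw [← e.symm.le_iff_le, ← e.symm.le_iff_le]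
  exact htotR _ _

end NoetherianSpectra

/-! ### Chains and fibres of monotone maps -/

section OrderDimension

/-- In a totally ordered set, a subset without strict chains of three elements has at most two
elements. -/
theorem Set.encard_le_two_of_forall_not_lt {α : Type*} [PartialOrder α]
    (htot : ∀ a b : α, a ≤ b ∨ b ≤ a) {s : Set α}
    (hs : ∀ a ∈ s, ∀ b ∈ s, ∀ c ∈ s, a < b → ¬ b < c) : s.encard ≤ 2 := by
  by_contra! h
  obtain ⟨t, hts, ht⟩ := Set.exists_subset_encard_eq (k := 3) (s := s)
    (by
      rw [show (3 : ℕ∞) = 2 + 1 by norm_num]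
      exact Order.add_one_le_of_lt h)
  obtain ⟨x, y, z, hxy, hxz, hyz, rfl⟩ := Set.encard_eq_three.1 ht
  have hx : x ∈ s := hts (by simp)
  have hy : y ∈ s := hts (by simp)
  have hz : z ∈ s := hts (by simp)
  have hlt {a b : α} (hab : a ≠ b) : a < b ∨ b < a :=
    (htot a b).imp (fun h => h.lt_of_ne hab) (fun h => h.lt_of_ne hab.symm)
  rcases hlt hxy with h1 | h1 <;> rcases hlt hxz with h2 | h2 <;> rcases hlt hyz with h3 | h3
  · exact hs _ hx _ hy _ hz h1 h3
  · exact hs _ hx _ hz _ hy h2 h3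
  · exact hs _ hx _ hy _ hz h1 h3
  · exact hs _ hz _ hx _ hy h2 h1
  · exact hs _ hy _ hx _ hz h1 h2
  · exact hs _ hz _ hy _ hx h3 h1
  · exact hs _ hy _ hz _ hx h3 h2
  · exact hs _ hz _ hy _ hx h3 h1

/-- If a monotone map of orders with least element has fibres of dimension at most one and only
the least element lies over the least element, then it at most doubles the dimension. -/
theorem Order.krullDim_le_two_mul_of_krullDim_preimage_le {α β : Type*} [PartialOrder α]
    [PartialOrder β] [OrderBot α] [OrderBot β] (f : α →o β) (hbot : ∀ x, f x = ⊥ → x = ⊥)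
    (h : ∀ y, Order.krullDim (f ⁻¹' {y}) ≤ 1) :
    Order.krullDim α ≤ 2 * Order.krullDim β := by
  refine iSup_le fun p => ?_
  rcases hp : p.length with _ | n
  · exact mul_nonneg zero_le_two Order.krullDim_nonneg
  · let i : Fin (p.length + 1) := ⟨1, by lia⟩
    have hi : p 0 < p i := p.strictMono (by simp [i, Fin.lt_def])
    have hfi : ⊥ < f (p i) := bot_lt_iff_ne_bot.2 fun h0 => (bot_le.trans_lt hi).ne' (hbot _ h0)
    have h1 : (n : ℕ∞) ≤ Order.coheight (p i) := by
      have := Order.length_le_coheight_head (p := p.drop i)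
      simpa [hp, i] using this
    -- The fibre bound has an extra `+ 1`, and dropping `p 0` costs another; `f (p i) > ⊥` pays for
    -- both.
    have h2 := Order.coheight_le_of_krullDim_preimage_le (m := 1) f (by simpa using h) (p i)
    have h3 : Order.coheight (f (p i)) + 1 ≤ Order.coheight (⊥ : β) :=
      Order.coheight_add_one_le hfi
    have h4 : ((n + 1 : ℕ) : ℕ∞) ≤ 2 * Order.coheight (⊥ : β) := by
      push_cast
      calc (n : ℕ∞) + 1 ≤ ((1 + 1) * Order.coheight (f (p i)) + 1) + 1 := by
            gcongr; exact h1.trans (by simpa using h2)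
        _ = 2 * (Order.coheight (f (p i)) + 1) := by ring
        _ ≤ _ := by gcongr
    calc ((n + 1 : ℕ) : WithBot ℕ∞) ≤ ((2 * Order.coheight (⊥ : β) : ℕ∞) : WithBot ℕ∞) :=
          WithBot.coe_le_coe.2 h4
      _ = 2 * ((Order.coheight (⊥ : β) : ℕ∞) : WithBot ℕ∞) := by rw [WithBot.coe_mul]; rfl
      _ ≤ _ := by
          gcongr
          exact Order.coheight_le_krullDim _

end OrderDimension

/-! ### Valuation rings dominating a local ring -/

section Domination

/-- An element of a field which is not integral over a local ring `R` is avoided by some valuation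
ring dominating the image of `R`. -/
theorem exists_valuationSubring_of_not_isIntegral {R K : Type*} [CommRing R] [Field K]
    [Algebra R K] [IsLocalRing R] {x : K} (hx : ¬ IsIntegral R x) :
    ∃ W : ValuationSubring K, (∀ r : R, algebraMap R K r ∈ W) ∧
      (∀ r ∈ maximalIdeal R, algebraMap R K r ∈ W.nonunits) ∧ x ∉ W := by
  have hx0 : x ≠ 0 := by
    rintro rfl
    exact hx isIntegral_zero
  let := invertibleOfNonzero hx0
  let B := Algebra.adjoin R {x⁻¹}
  let xinv : B := ⟨x⁻¹, subset_adjoin rfl⟩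
  -- Otherwise `x` is a root of a polynomial with leading coefficient congruent to 1 modulo the
  -- maximal ideal, hence a unit, and `x` is integral.
  have hne : (maximalIdeal R).map (algebraMap R B) ⊔ Ideal.span {xinv} ≠ ⊤ := fun eq => by
    obtain ⟨p, hp, hpx⟩ := exists_aeval_invOf_eq_zero_of_idealMap_adjoin_sup_span_eq_top _ _
      (maximalIdeal.isMaximal R).ne_top eq
    have H : IsUnit p.leadingCoeff := of_not_not fun h ↦ by simpa using sub_mem h hp
    refine hx ⟨.C (H.unit⁻¹ : Rˣ).1 * p, by simp [Polynomial.Monic, Polynomial.leadingCoeff_mul'], ?_⟩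
    rw [← Polynomial.aeval_def]
    simpa using .inr hpx
  obtain ⟨W, hBW, hW⟩ := Ideal.image_subset_nonunits_valuationSubring (A := B.toSubring) _ hne
  refine ⟨W, fun r => hBW (B.algebraMap_mem r), fun r hr => ?_, ?_⟩
  · exact hW ⟨algebraMap R B r, (le_sup_left : _ ≤ _ ⊔ Ideal.span {xinv})
      (Ideal.mem_map_of_mem _ hr), rfl⟩
  · exact (W.inv_mem_nonunits_iff.mp <| hW ⟨xinv, (le_sup_right :
      _ ≤ (maximalIdeal R).map (algebraMap R B) ⊔ _)
      (Ideal.subset_span rfl), rfl⟩).resolve_left hx0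

end Domination

/-! ### Valuation overrings and the Zariski space -/

namespace Zar

variable {D K : Type*} [CommRing D] [Field K] [Algebra D K]

theorem isOpen_basicOpen (F : Finset K) : IsOpen (basicOpen D F) :=
  TopologicalSpace.isOpen_generateFrom_of_mem ⟨F, rfl⟩

/-- The primes of a valuation overring are totally ordered. -/
theorem primeSpectrum_total (V : Zar D K) (p q : PrimeSpectrum V.ring) : p ≤ q ∨ q ≤ p :=
  Std.Total.total (r := (· ≤ ·)) p.asIdeal q.asIdeal

/-- A minimal valuation overring with compact complement is determined by a finite set of elements
of its maximal ideal. -/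
theorem exists_finset_subset_nonunits {V : Zar D K} (hV : IsMin V)
    (hc : IsCompact ({V}ᶜ : Set (Zar D K))) :
    ∃ S : Finset K, (∀ s ∈ S, s ∈ V.ring.nonunits) ∧
      ∀ W : Zar D K, (∀ s ∈ S, s ∈ W.ring.nonunits) → W = V := by
  classical
  -- By minimality every `W ≠ V` contains some `x ∉ V`; the inverses of finitely many such `x` form
  -- `S`.
  obtain ⟨t, ht⟩ := hc.elim_finite_subcover
    (fun x : {x : K // x ∉ V.ring} => basicOpen D {x.1}) (fun x => isOpen_basicOpen _) (by
      intro W hW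
      have hWV : ¬ W ≤ V := fun h => hW (le_antisymm h (hV h))
      obtain ⟨x, hxW, hxV⟩ := SetLike.not_le_iff_exists.1 (show ¬ W.ring ≤ V.ring from hWV)
      exact Set.mem_iUnion.2 ⟨⟨x, hxV⟩, by simpa [basicOpen] using hxW⟩)
  refine ⟨t.image fun x => x.1⁻¹, ?_, fun W hW => ?_⟩
  · simp only [Finset.mem_image, forall_exists_index, and_imp]
    rintro _ x - rfl
    exact V.ring.inv_mem_nonunits_iff.2 (.inr x.2)
  · by_contra hne
    obtain ⟨x, hxt, hx⟩ := Set.mem_iUnion₂.1 (ht hne)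
    have hxW : x.1 ∈ W.ring := by simpa [basicOpen] using hx
    rcases W.ring.inv_mem_nonunits_iff.1 (hW _ (Finset.mem_image_of_mem _ hxt)) with h0 | h
    · exact x.2 (h0 ▸ V.ring.zero_mem)
    · exact h hxW

/-- A valuation overring which is determined by a finite set of elements of its maximal ideal has
no strict chain of three primes with the same contraction to `D`. -/
theorem not_lt_of_lt_of_specMap_eq {V : Zar D K} {S : Finset K}
    (hSV : ∀ s ∈ S, s ∈ V.ring.nonunits)
    (hS : ∀ W : Zar D K, (∀ s ∈ S, s ∈ W.ring.nonunits) → W = V) {P : PrimeSpectrum D}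
    {q₁ q₂ q₃ : PrimeSpectrum V.ring} (h₁ : V.specMap q₁ = P) (h₂ : V.specMap q₂ = P)
    (h₃ : V.specMap q₃ = P) (h₁₂ : q₁ < q₂) : ¬ q₂ < q₃ := by
  let A := Algebra.adjoin D (S : Set K)
  have : Algebra.FiniteType D A := .adjoin_of_finite S.finite_toSet
  let VD : Subalgebra D K := { V.ring.toSubring with algebraMap_mem' := V.2 }
  have hAV : A ≤ VD := Algebra.adjoin_le fun s hs => V.ring.nonunits_subset (hSV s hs)
  let g : A →+* V.ring := A.val.toRingHom.codRestrict V.ring.toSubring fun a => hAV a.2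
  have hg : Function.Injective g := fun a b hab => Subtype.ext congr(($hab : K))
  let M : Ideal A := (maximalIdeal V.ring).comap g
  have hM : M.IsPrime := Ideal.comap_isPrime g _
  have hgM (y : M.primeCompl) : IsUnit (g y) := by
    by_contra h
    exact y.2 h
  let R := Localization.AtPrime M
  let f : R →+* V.ring := IsLocalization.lift hgM
  have hfA (a : A) : f (algebraMap A R a) = g a := IsLocalization.lift_eq hgM a
  have hf : Function.Injective f := (IsLocalization.lift_injective_iff hgM).2 fun x y => by
    rw [(IsLocalization.injective R M.primeCompl_le_nonZeroDivisors).eq_iff, hg.eq_iff]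
  let _ : Algebra R V.ring := f.toAlgebra
  let _ : Algebra R K := (V.ring.subtype.comp f).toAlgebra
  let _ : Algebra D V.ring := V.incl.toAlgebra
  have : IsScalarTower R V.ring K := .of_algebraMap_eq fun _ => rfl
  have hDR (d : D) : f (algebraMap D R d) = V.incl d := by
    rw [IsScalarTower.algebraMap_apply D A R, hfA]
    rfl
  have : IsScalarTower D R V.ring := .of_algebraMap_eq fun d => (hDR d).symm
  have : FaithfulSMul R V.ring := (faithfulSMul_iff_algebraMap_injective R V.ring).2 hf
  -- A non-integral `v` would be avoided by some `W` dominating `R`; since `S ⊆ M`, such a `W`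
  -- equals `V`.
  have : Algebra.IsIntegral R V.ring := by
    refine ⟨fun v => ?_⟩
    rw [← isIntegral_algebraMap_iff (B := K) Subtype.val_injective]
    by_contra hv
    obtain ⟨W, hRW, hmW, hvW⟩ := exists_valuationSubring_of_not_isIntegral hv
    have hWV := hS ⟨W, fun d => by
      have h := hRW (algebraMap D R d)
      change ((f (algebraMap D R d) : V.ring) : K) ∈ W at h
      rwa [hDR] at h⟩ fun s hs => by
        let a : A := ⟨s, subset_adjoin hs⟩
        have ha : a ∈ M := by
          obtain ⟨_, h⟩ := ValuationSubring.mem_nonunits_iff_exists_mem_maximalIdeal.1 (hSV s hs)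
          exact h
        have h := hmW (algebraMap A R a)
          ((IsLocalization.AtPrime.to_map_mem_maximal_iff R M a).2 ha)
        change ((f (algebraMap A R a) : V.ring) : K) ∈ W.nonunits at h
        rwa [hfA] at h
    exact hvW ((congrArg Zar.ring hWV).ge v.2)
  exact PrimeSpectrum.not_lt_of_lt_of_comap_eq (R := R) V.primeSpectrum_total h₁ h₂ h₃ h₁₂

/-- Only the zero ideal of a valuation overring lies over the zero ideal of `D`. -/
theorem eq_bot_of_specMap_eq_bot [IsDomain D] [IsFractionRing D K] (V : Zar D K)
    (Q : PrimeSpectrum V.ring) (hQ : V.specMap Q = ⊥) : Q = ⊥ := by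
  refine le_bot_iff.1 fun x hx => ?_
  obtain ⟨a, b, hb, hab⟩ := IsFractionRing.div_surjective (A := D) (x : K)
  have hb0 : algebraMap D K b ≠ 0 := IsFractionRing.to_map_ne_zero_of_mem_nonZeroDivisors hb
  have hax : V.incl a = x * V.incl b := Subtype.ext ((div_eq_iff hb0).1 hab)
  have ha : a ∈ (V.specMap Q).asIdeal := by
    change V.incl a ∈ Q.asIdeal
    rw [hax]
    exact Q.asIdeal.mul_mem_right _ hx
  rw [hQ] at ha
  have ha0 : a = 0 := ha
  have hx0 : x = 0 := Subtype.ext (by rw [← hab, ha0]; simp)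
  rw [hx0]
  exact zero_mem _

theorem ringKrullDim_le_two_mul [IsDomain D] [IsFractionRing D K] (V : Zar D K)
    (hV : ∀ (P : PrimeSpectrum D) (q₁ q₂ q₃ : PrimeSpectrum V.ring), V.specMap q₁ = P →
      V.specMap q₂ = P → V.specMap q₃ = P → q₁ < q₂ → ¬ q₂ < q₃) :
    ringKrullDim V.ring ≤ 2 * ringKrullDim D := by
  refine Order.krullDim_le_two_mul_of_krullDim_preimage_le
    (⟨V.specMap, fun _ _ h => Ideal.comap_mono h⟩ : PrimeSpectrum V.ring →o PrimeSpectrum D)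
    V.eq_bot_of_specMap_eq_bot fun P => ?_
  refine Order.krullDim_le_one_iff.2 fun x => ?_
  by_contra! h
  obtain ⟨⟨y, hy⟩, ⟨z, hz⟩⟩ := And.imp not_isMin_iff.1 not_isMax_iff.1 h
  exact hV P y x z y.2 x.2 z.2 hy hz

/-- Passing to a smaller valuation overring does not decrease the dimension. -/
theorem ringKrullDim_anti {V W : Zar D K} (h : W ≤ V) :
    ringKrullDim V.ring ≤ ringKrullDim W.ring := by
  have h' : W.ring ≤ V.ring := h
  let φ : W.ring →+* V.ring := ValuationSubring.inclusion _ _ h'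
  refine Order.krullDim_le_of_strictMono (PrimeSpectrum.comap φ) fun p q hpq => ?_
  obtain ⟨x, hxq, hxp⟩ := SetLike.exists_of_lt (show p.asIdeal < q.asIdeal from hpq)
  -- The maximal ideal of `V` lies in that of `W`, so elements of `q` already belong to `W`.
  have hxW : (x : K) ∈ W.ring := by
    refine W.ring.nonunits_subset ((ValuationSubring.nonunits_le_nonunits.2 h') ?_)
    exact ValuationSubring.mem_nonunits_iff_exists_mem_maximalIdeal.2
      ⟨x.2, le_maximalIdeal q.isPrime.ne_top hxq⟩
  refine lt_of_le_not_ge (Ideal.comap_mono hpq.le) fun hle => hxp ?_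
  exact hle (show (⟨x, hxW⟩ : W.ring) ∈ (PrimeSpectrum.comap φ q).asIdeal from hxq)

/-- The Zariski closure of a point consists of the valuation overrings contained in it. -/
theorem mem_closure_singleton_iff {V W : Zar D K} : W ∈ closure {V} ↔ W ≤ V := by
  rw [← specializes_iff_mem_closure, specializes_iff_forall_open]
  refine ⟨fun h x hx => ?_, fun h U hU => ?_⟩
  · simpa [basicOpen] using h (basicOpen D {x}) (isOpen_basicOpen _) (by simpa [basicOpen] using hx)
  · induction hU with
    | basic U hU =>
      obtain ⟨F, rfl⟩ := hU
      exact fun hW x hx => h (hW x hx)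
    | univ => exact id
    | inter U₁ U₂ _ _ h₁ h₂ => exact And.imp h₁ h₂
    | sUnion 𝒰 _ ih => exact fun ⟨U, hU, hW⟩ => ⟨U, hU, ih U hU hW⟩

/-- If the Zariski space is Noetherian, then every valuation overring contains a minimal one. -/
theorem exists_isMin_le [TopologicalSpace.NoetherianSpace (Zar D K)] (V : Zar D K) :
    ∃ W ≤ V, IsMin W := by
  -- Inclusion is reflected by point closures, so the descending chain condition on closed sets
  -- passes to `Zar D K`.
  have hmono : StrictMono fun V : Zar D K => TopologicalSpace.Closeds.closure {V} := by
    refine fun V W h => lt_of_le_not_ge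
      (fun X hX => mem_closure_singleton_iff.2 ((mem_closure_singleton_iff.1 hX).trans h.le))
      fun hle => h.not_ge ?_
    exact mem_closure_singleton_iff.1 (hle (mem_closure_singleton_iff.2 le_rfl))
  have : WellFoundedLT (Zar D K) := hmono.wellFoundedLT
  obtain ⟨W, hWV, hW⟩ := exists_minimal_le_of_wellFoundedLT (fun _ : Zar D K => True) V trivial
  exact ⟨W, hWV, minimal_true.1 hW⟩

end Zar

theorem mainTheorem4 (D K : Type*) [CommRing D] [IsDomain D] [Field K] [Algebra D K]
    [IsFractionRing D K] :
    (∀ V : Zar D K, IsMin V → IsCompact ({V}ᶜ : Set (Zar D K)) →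
      (∀ P : PrimeSpectrum D, (V.specMap ⁻¹' {P}).encard ≤ 2) ∧
        ringKrullDim V.ring ≤ 2 * ringKrullDim D) ∧
    (TopologicalSpace.NoetherianSpace (Zar D K) →
      valuativeDim D K ≤ 2 * ringKrullDim D) := by
  have key (V : Zar D K) (hV : IsMin V) (hc : IsCompact ({V}ᶜ : Set (Zar D K))) :
      (∀ P : PrimeSpectrum D, (V.specMap ⁻¹' {P}).encard ≤ 2) ∧
        ringKrullDim V.ring ≤ 2 * ringKrullDim D := by
    obtain ⟨S, hSV, hS⟩ := Zar.exists_finset_subset_nonunits hV hc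
    refine ⟨fun P => Set.encard_le_two_of_forall_not_lt V.primeSpectrum_total
      fun _ h₁ _ h₂ _ h₃ => Zar.not_lt_of_lt_of_specMap_eq hSV hS h₁ h₂ h₃, ?_⟩
    exact V.ringKrullDim_le_two_mul fun _ _ _ _ => Zar.not_lt_of_lt_of_specMap_eq hSV hS
  refine ⟨key, fun hN => iSup_le fun V => ?_⟩
  obtain ⟨W, hWV, hW⟩ := Zar.exists_isMin_le V
  exact (Zar.ringKrullDim_anti hWV).trans
    (key W hW (TopologicalSpace.NoetherianSpace.isCompact _)).2
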